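/- Let $(x_k)_{k\ge 1}$ denote either the base-2 van der Corput sequence $\tfrac12,\tfrac14,\tfrac34,\tfrac18,\tfrac58,\tfrac38,\tfrac78,\dots$ (that is, $x_k=\sum_i d_i 2^{-i-1}$ if $k=\sum_i d_i 2^i$ with $d_i\in\{0,1\}$), or the Kronecker sequence $x_k=\{k\varphi\}$, where $\varphi=(1+\sqrt5)/2$ and $\{y\}=y-\lfloor y\rfloor$. There exists a universal constant $c>0$ such that for every integer $r\ge 2$ and all sufficiently large $n\in\mathbb N$ (depending on $r$), the following two statements hold. (i) For all $0\le t\le 1-r/n$, $$\left|\#\left\{1\le k\le n:\ t\le x_k\le t+\frac rn\right\}-r\right|\le c\log r.$$ (ii) More generally, the same holds for all arcs of length $r/n$ on the circle $\mathbb S^1=\mathbb R/\mathbb Z$: for every $t\in\mathbb R$, $$\left|\#\left\{1\le k\le n:\ x_k \bmod 1\in\left\{s \bmod 1:\ t\le s\le t+\frac rn\right\}\right\}-r\right|\le c\log r.$$ -/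

import Mathlib

/-- The base-2 van der Corput sequence: if `k = ∑ i, dᵢ 2 ^ i` is the binary expansion of `k`, then
`vanDerCorput k = ∑ i, dᵢ / 2 ^ (i + 1)`. Thus the values at `k = 1, 2, 3, 4, 5, …` are
`1/2, 1/4, 3/4, 1/8, 5/8, …`. -/
noncomputable def vanDerCorput (k : ℕ) : ℝ :=
  Nat.ofDigits (1 / 2 : ℝ) (Nat.digits 2 k) / 2

/-- The golden ratio Kronecker sequence `{k φ}`, where `φ = (1 + √5) / 2`. -/
noncomputable def goldenKronecker (k : ℕ) : ℝ :=
  Int.fract ((k : ℝ) * Real.goldenRatio)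

/-- The closed arc of length `L` (for `0 ≤ L ≤ 1`) on the circle `ℝ / ℤ` that starts at `t` and runs
in the positive direction. -/
def circleArc (t L : ℝ) : Set UnitAddCircle :=
  (fun s : ℝ => (s : UnitAddCircle)) '' Set.Icc t (t + L)

/-! Counting reduces to bounding D(t + r/n) - D(t) by O(log r), where D = `fractSum x n`; D has
period 1, and D(t) + nt is monotone, so errors of O(1/n) in the endpoints cost O(1). For each
sequence there are special arcs on which D changes by O(1), whatever n is. For van der Corput they
are the dyadic cells, which catch one residue class of indices
(`abs_fractSum_vanDerCorput_dyadic_le`). For the golden rotation they are the arcs of length φ⁻ʲ, by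
the Denjoy–Koksma inequality (`abs_fractSum_golden_add_pow_le`). An arc of length r/n is, up to
O(1/n), a union of O(log r) special arcs, because only the scales between r/n and 1/n are needed. -/

/-- The sum of the fractional parts `{x k - t}` over `1 ≤ k ≤ n`. The number of points in a half-open
arc from `s` to `t` exceeds its expected value `n (t - s)` by the difference of the values at `t` and
`s`. -/
noncomputable def fractSum (x : ℕ → ℝ) (n : ℕ) (t : ℝ) : ℝ :=
  ∑ k ∈ Finset.Ioc 0 n, Int.fract (x k - t)

/-! ### Arc counts as increments of `fractSum` -/

theorem fractSum_add_int (x : ℕ → ℝ) (n : ℕ) (t : ℝ) (z : ℤ) :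
    fractSum x n (t + z) = fractSum x n t := by
  unfold fractSum
  refine Finset.sum_congr rfl fun k _ => ?_
  rw [← sub_sub, Int.fract_sub_intCast]

theorem fractSum_sub_eq (x : ℕ → ℝ) (n : ℕ) (s t : ℝ) :
    fractSum x n t - fractSum x n s + n * (t - s) =
      ∑ k ∈ Finset.Ioc 0 n, ((⌊x k - s⌋ - ⌊x k - t⌋ : ℤ) : ℝ) := by
  have h : (n : ℝ) * (t - s) = ∑ _k ∈ Finset.Ioc 0 n, (t - s) := by
    rw [Finset.sum_const, Nat.card_Ioc, nsmul_eq_mul, Nat.sub_zero]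
  unfold fractSum
  rw [h, ← Finset.sum_sub_distrib, ← Finset.sum_add_distrib]
  refine Finset.sum_congr rfl fun k _ => ?_
  push_cast
  unfold Int.fract
  ring

theorem monotone_fractSum_add_mul (x : ℕ → ℝ) (n : ℕ) :
    Monotone fun t => fractSum x n t + n * t := by
  intro s t hst
  have h := fractSum_sub_eq x n s t
  have : (0 : ℝ) ≤ ∑ k ∈ Finset.Ioc 0 n, ((⌊x k - s⌋ - ⌊x k - t⌋ : ℤ) : ℝ) := by
    refine Finset.sum_nonneg fun k _ => ?_
    have : ⌊x k - t⌋ ≤ ⌊x k - s⌋ := Int.floor_mono (by linarith)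
    exact_mod_cast sub_nonneg.2 this
  simp only
  linarith

theorem coe_mem_circleArc_iff {y t L : ℝ} :
    (y : UnitAddCircle) ∈ circleArc t L ↔ ∃ z : ℤ, t ≤ y + z ∧ y + z ≤ t + L := by
  constructor
  · rintro ⟨s, ⟨h1, h2⟩, hs⟩
    have : ((s - y : ℝ) : UnitAddCircle) = 0 := by
      rw [AddCircle.coe_sub]; exact sub_eq_zero.2 hs
    obtain ⟨z, hz⟩ := (AddCircle.coe_eq_zero_iff (1 : ℝ)).1 this
    have hz' : (z : ℝ) = s - y := by simpa using hz
    exact ⟨z, by linarith, by linarith⟩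
  · rintro ⟨z, h1, h2⟩
    refine ⟨y + z, ⟨h1, h2⟩, ?_⟩
    simp

open Classical in
theorem ncard_circleArc_eq_sum (x : ℕ → ℝ) (n : ℕ) (t L : ℝ) :
    (({k : ℕ | 1 ≤ k ∧ k ≤ n ∧ (x k : UnitAddCircle) ∈ circleArc t L}.ncard : ℕ) : ℝ) =
      ∑ k ∈ Finset.Ioc 0 n, if (x k : UnitAddCircle) ∈ circleArc t L then (1 : ℝ) else 0 := by
  have : {k : ℕ | 1 ≤ k ∧ k ≤ n ∧ (x k : UnitAddCircle) ∈ circleArc t L} =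
      ((Finset.Ioc 0 n).filter fun k => (x k : UnitAddCircle) ∈ circleArc t L : Finset ℕ) := by
    ext k
    simp only [Set.mem_ofPred_eq, Finset.coe_filter, Finset.mem_Ioc]
    rw [Nat.succ_le_iff, and_assoc]
  rw [this, Set.ncard_coe_finset, Finset.sum_boole]

/-- The floor difference counts the lifts of a point lying in the half-open arc; for `L ≤ 1` this is
at most 1, and it is 0 off the closed arc. -/
theorem le_ncard_circleArc (x : ℕ → ℝ) (n : ℕ) {t L : ℝ} (hL : L ≤ 1) :
    fractSum x n (t + L) - fractSum x n t + n * L ≤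
      ({k : ℕ | 1 ≤ k ∧ k ≤ n ∧ (x k : UnitAddCircle) ∈ circleArc t L}.ncard : ℕ) := by
  have h := fractSum_sub_eq x n t (t + L)
  rw [add_sub_cancel_left] at h
  rw [h, ncard_circleArc_eq_sum]
  refine Finset.sum_le_sum fun k _ => ?_
  have h1 := Int.floor_le (x k - t)
  have h2 := Int.lt_floor_add_one (x k - (t + L))
  split_ifs with hk
  · have : ((⌊x k - t⌋ : ℝ)) < ⌊x k - (t + L)⌋ + 2 := by linarith
    have : ⌊x k - t⌋ < ⌊x k - (t + L)⌋ + 2 := by exact_mod_cast this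
    exact_mod_cast (show ⌊x k - t⌋ - ⌊x k - (t + L)⌋ ≤ 1 by omega)
  · by_contra! hlt
    have hlt' : 0 < ⌊x k - t⌋ - ⌊x k - (t + L)⌋ := by exact_mod_cast hlt
    have : ((⌊x k - (t + L)⌋ : ℝ)) + 1 ≤ ⌊x k - t⌋ := by
      exact_mod_cast (show ⌊x k - (t + L)⌋ + 1 ≤ ⌊x k - t⌋ by omega)
    refine hk (coe_mem_circleArc_iff.2 ⟨-⌊x k - t⌋, ?_, ?_⟩) <;> push_cast <;> linarith

/-- The strictly longer half-open arc absorbs the closed endpoint. -/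
theorem ncard_circleArc_le (x : ℕ → ℝ) (n : ℕ) {t L M : ℝ} (hM : 0 ≤ M) (hLM : L < M) :
    (({k : ℕ | 1 ≤ k ∧ k ≤ n ∧ (x k : UnitAddCircle) ∈ circleArc t L}.ncard : ℕ) : ℝ) ≤
      fractSum x n (t + M) - fractSum x n t + n * M := by
  have h := fractSum_sub_eq x n t (t + M)
  rw [add_sub_cancel_left] at h
  rw [h, ncard_circleArc_eq_sum]
  refine Finset.sum_le_sum fun k _ => ?_
  split_ifs with hk
  · obtain ⟨z, h1, h2⟩ := coe_mem_circleArc_iff.1 hk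
    have h3 : -z ≤ ⌊x k - t⌋ := Int.le_floor.2 (by push_cast; linarith)
    have h4 : ⌊x k - (t + M)⌋ < -z := Int.floor_lt.2 (by push_cast; linarith)
    exact_mod_cast (show 1 ≤ ⌊x k - t⌋ - ⌊x k - (t + M)⌋ by omega)
  · have : ⌊x k - (t + M)⌋ ≤ ⌊x k - t⌋ := Int.floor_mono (by linarith)
    exact_mod_cast sub_nonneg.2 this

/-! ### The van der Corput sequence -/

theorem vanDerCorput_zero : vanDerCorput 0 = 0 := by
  simp [vanDerCorput, Nat.ofDigits]

theorem vanDerCorput_two_mul_add (q b : ℕ) (hb : b < 2) :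
    vanDerCorput (2 * q + b) = b / 2 + vanDerCorput q / 2 := by
  rcases Nat.eq_zero_or_pos (2 * q + b) with h | h
  · obtain ⟨rfl, rfl⟩ : q = 0 ∧ b = 0 := by omega
    simp [vanDerCorput_zero]
  · have : Nat.digits 2 (2 * q + b) = b :: Nat.digits 2 q := by
      rw [Nat.digits_def' (by norm_num) h]
      congr 2 <;> omega
    simp only [vanDerCorput, this, Nat.ofDigits]
    ring

theorem vanDerCorput_mem_Ico (k : ℕ) : vanDerCorput k ∈ Set.Ico (0 : ℝ) 1 := by
  induction k using Nat.strong_induction_on with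
  | _ k ih =>
    rcases Nat.eq_zero_or_pos k with rfl | hk
    · simp [vanDerCorput_zero]
    · have h := vanDerCorput_two_mul_add (k / 2) (k % 2) (Nat.mod_lt _ (by norm_num))
      rw [Nat.div_add_mod] at h
      obtain ⟨h0, h1⟩ := ih (k / 2) (by omega)
      have hb : ((k % 2 : ℕ) : ℝ) ≤ 1 := by exact_mod_cast (by omega : k % 2 ≤ 1)
      have hb0 : (0 : ℝ) ≤ ((k % 2 : ℕ) : ℝ) := Nat.cast_nonneg _
      rw [h]
      constructor <;> linarith

theorem vanDerCorput_pos {k : ℕ} (hk : 0 < k) : 0 < vanDerCorput k := by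
  induction k using Nat.strong_induction_on with
  | _ k ih =>
    have h := vanDerCorput_two_mul_add (k / 2) (k % 2) (Nat.mod_lt _ (by norm_num))
    rw [Nat.div_add_mod] at h
    rw [h]
    rcases Nat.eq_zero_or_pos (k / 2) with h2 | h2
    · obtain rfl : k = 1 := by omega
      have := (vanDerCorput_mem_Ico (1 / 2)).1
      norm_num at this ⊢
      linarith
    · have := ih (k / 2) (by omega) h2
      positivity

/-- A dyadic interval holds exactly the terms whose index lies in one residue class. -/
theorem exists_modEq_iff_vanDerCorput_mem (m : ℕ) :
    ∀ a : ℕ, a < 2 ^ m → ∃ ρ : ℕ, ρ < 2 ^ m ∧ ∀ k : ℕ, k % 2 ^ m = ρ ↔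
      (a : ℝ) / 2 ^ m ≤ vanDerCorput k ∧ vanDerCorput k < (a + 1) / 2 ^ m := by
  induction m with
  | zero =>
    intro a ha
    obtain rfl : a = 0 := by simpa using ha
    refine ⟨0, by simp, fun k => ?_⟩
    have := vanDerCorput_mem_Ico k
    simp [Nat.mod_one, this.1, this.2]
  | succ m ih =>
    intro a ha
    -- The leading bit `b` of the cell index prescribes the last bit of `k`, since digit reversal
    -- swaps the two.
    obtain ⟨a', b, hb, ha', rfl⟩ : ∃ a' b, b < 2 ∧ a' < 2 ^ m ∧ a = b * 2 ^ m + a' := by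
      refine ⟨a % 2 ^ m, a / 2 ^ m, ?_, Nat.mod_lt _ (by positivity), ?_⟩
      · rw [Nat.div_lt_iff_lt_mul (by positivity)]; rw [pow_succ] at ha; omega
      · rw [mul_comm]; exact (Nat.div_add_mod _ _).symm
    obtain ⟨ρ, hρ, h⟩ := ih a' ha'
    refine ⟨2 * ρ + b, by rw [pow_succ]; omega, fun k => ?_⟩
    obtain ⟨q, e, he, rfl⟩ : ∃ q e, e < 2 ∧ k = 2 * q + e := ⟨k / 2, k % 2, by omega, by omega⟩
    have hmod : (2 * q + e) % 2 ^ (m + 1) = 2 * (q % 2 ^ m) + e := by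
      rw [pow_succ', Nat.mod_mul]
      have : (2 * q + e) / 2 = q := by omega
      rw [this]; omega
    rw [hmod, vanDerCorput_two_mul_add _ _ he]
    have hP : (0 : ℝ) < 2 ^ m := by positivity
    have hq := vanDerCorput_mem_Ico q
    have h' := h q
    rw [div_le_iff₀ hP, lt_div_iff₀ hP] at h'
    rw [div_le_iff₀ (by positivity), lt_div_iff₀ (by positivity), pow_succ]
    push_cast
    have ha'' : (a' : ℝ) + 1 ≤ 2 ^ m := by exact_mod_cast ha'
    have ha0 : (0 : ℝ) ≤ a' := Nat.cast_nonneg _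
    have hv0 : 0 ≤ vanDerCorput q * 2 ^ m := mul_nonneg hq.1 hP.le
    have hv1 : vanDerCorput q * 2 ^ m < 2 ^ m := by nlinarith [hq.2]
    interval_cases b <;> interval_cases e
    · rw [show 2 * (q % 2 ^ m) + 0 = 2 * ρ + 0 ↔ q % 2 ^ m = ρ by omega, h']
      push_cast
      constructor <;> rintro ⟨h1, h2⟩ <;> constructor <;> linarith
    · refine iff_of_false (by omega) ?_
      push_cast
      rintro ⟨h1, h2⟩
      linarith
    · refine iff_of_false (by omega) ?_
      push_cast
      rintro ⟨h1, h2⟩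
      linarith
    · rw [show 2 * (q % 2 ^ m) + 1 = 2 * ρ + 1 ↔ q % 2 ^ m = ρ by omega, h']
      push_cast
      constructor <;> rintro ⟨h1, h2⟩ <;> constructor <;> linarith

theorem abs_card_Ioc_filter_mod_sub_le (n : ℕ) {M ρ : ℕ} (hM : 0 < M) (hρ : ρ < M) :
    |(((Finset.Ioc 0 n).filter fun k => k % M = ρ).card : ℝ) - n / M| ≤ 1 := by
  have h := Nat.Ioc_filter_modEq_card 0 n hM ρ
  have e : (Finset.Ioc 0 n).filter (fun k => k ≡ ρ [MOD M]) =
      (Finset.Ioc 0 n).filter fun k => k % M = ρ := by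
    refine Finset.filter_congr fun k _ => ?_
    rw [Nat.ModEq, Nat.mod_eq_of_lt hρ]
  rw [e] at h
  set c := ((Finset.Ioc 0 n).filter fun k => k % M = ρ).card
  have hM' : (0 : ℚ) < M := by exact_mod_cast hM
  have hle : ⌊((0 : ℕ) - (ρ : ℚ)) / M⌋ ≤ ⌊((n : ℚ) - ρ) / M⌋ := by
    apply Int.floor_mono
    gcongr
    simp
  rw [max_eq_left (sub_nonneg.2 hle)] at h
  have h' : (c : ℚ) = ⌊((n : ℚ) - ρ) / M⌋ - ⌊((0 : ℕ) - (ρ : ℚ)) / M⌋ := by exact_mod_cast h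
  have h1 := Int.floor_le (((n : ℚ) - ρ) / M)
  have h2 := Int.lt_floor_add_one (((n : ℚ) - ρ) / M)
  have h3 := Int.floor_le (((0 : ℕ) - (ρ : ℚ)) / M)
  have h4 := Int.lt_floor_add_one (((0 : ℕ) - (ρ : ℚ)) / M)
  rw [sub_div] at h1 h2 h3 h4
  have h0 : (((0 : ℕ) : ℚ)) / M = 0 := by simp
  have hc : |(c : ℚ) - n / M| ≤ 1 := by
    rw [sub_div, sub_div] at h'
    rw [abs_le]; constructor <;> linarith
  have := (Rat.cast_le (K := ℝ)).2 hc
  push_cast at this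
  exact this

theorem abs_fractSum_vanDerCorput_dyadic_le (n m : ℕ) (a : ℤ) :
    |fractSum vanDerCorput n ((a + 1) / 2 ^ m) - fractSum vanDerCorput n (a / 2 ^ m)| ≤ 1 := by
  have hP : (0 : ℝ) < 2 ^ m := by positivity
  have hPz : (0 : ℤ) < 2 ^ m := by positivity
  obtain ⟨b, hb⟩ := Int.eq_ofNat_of_zero_le (Int.emod_nonneg a hPz.ne')
  have hb2 : b < 2 ^ m := by
    have := Int.emod_lt_of_pos a hPz
    rw [hb] at this; exact_mod_cast this
  have ha : (a : ℝ) = 2 ^ m * ((a / 2 ^ m : ℤ) : ℝ) + b := by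
    have := (Int.mul_ediv_add_emod a (2 ^ m)).symm
    rw [hb] at this
    exact_mod_cast this
  have e1 : (a : ℝ) / 2 ^ m = b / 2 ^ m + ((a / 2 ^ m : ℤ) : ℝ) := by
    field_simp; linarith
  have e2 : ((a : ℝ) + 1) / 2 ^ m = (b + 1) / 2 ^ m + ((a / 2 ^ m : ℤ) : ℝ) := by
    field_simp; linarith
  rw [e1, e2, fractSum_add_int, fractSum_add_int]
  obtain ⟨ρ, hρ, h⟩ := exists_modEq_iff_vanDerCorput_mem m b hb2
  have hs := fractSum_sub_eq vanDerCorput n (b / 2 ^ m) ((b + 1) / 2 ^ m)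
  have hc := abs_card_Ioc_filter_mod_sub_le n (show 0 < 2 ^ m by positivity) hρ
  rw [← Finset.sum_boole] at hc
  have key : ∑ k ∈ Finset.Ioc 0 n, ((⌊vanDerCorput k - b / 2 ^ m⌋ -
      ⌊vanDerCorput k - (b + 1) / 2 ^ m⌋ : ℤ) : ℝ) =
      ∑ k ∈ Finset.Ioc 0 n, if k % 2 ^ m = ρ then (1 : ℝ) else 0 := by
    refine Finset.sum_congr rfl fun k _ => ?_
    obtain ⟨hv0, hv1⟩ := vanDerCorput_mem_Ico k
    have hb0 : (0 : ℝ) ≤ b / 2 ^ m := by positivity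
    have hb1 : ((b : ℝ) + 1) / 2 ^ m ≤ 1 := by
      rw [div_le_one hP]; exact_mod_cast hb2
    have hlt : (b : ℝ) / 2 ^ m < (b + 1) / 2 ^ m := by gcongr; linarith
    have f0 : ∀ y : ℝ, 0 ≤ y → y < 1 → ⌊y⌋ = 0 := fun y h0 h1 => Int.floor_eq_zero_iff.2 ⟨h0, h1⟩
    have f1 : ∀ y : ℝ, -1 ≤ y → y < 0 → ⌊y⌋ = -1 := fun y h0 h1 =>
      Int.floor_eq_iff.2 ⟨by push_cast; linarith, by push_cast; linarith⟩
    have hk := h k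
    split_ifs with hρk
    · obtain ⟨_, _⟩ := hk.1 hρk
      rw [f0 _ (by linarith) (by linarith), f1 _ (by linarith) (by linarith)]; norm_num
    · by_cases h1 : (b : ℝ) / 2 ^ m ≤ vanDerCorput k
      · have h2 : ((b : ℝ) + 1) / 2 ^ m ≤ vanDerCorput k := by
          by_contra! h2; exact hρk (hk.2 ⟨h1, h2⟩)
        rw [f0 _ (by linarith) (by linarith), f0 _ (by linarith) (by linarith)]; norm_num
      · rw [f1 _ (by linarith) (by linarith), f1 _ (by linarith) (by linarith)]; norm_num
  rw [key] at hs
  have e3 : (n : ℝ) * ((b + 1) / 2 ^ m - b / 2 ^ m) = n / (2 ^ m : ℕ) := by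
    push_cast; ring
  rw [e3] at hs
  rw [← hs, add_sub_cancel_right] at hc
  exact hc

/-- Strip at most one cell from each end so that both endpoints lie on the next coarser grid. This
costs 2 and at least halves the number of cells, so about log₂ s rounds suffice; at level 0
periodicity ends the descent. -/
theorem abs_fractSum_vanDerCorput_dyadic_add_le (n m : ℕ) :
    ∀ (a : ℤ) (s : ℕ), |fractSum vanDerCorput n ((a + s) / 2 ^ m) -
      fractSum vanDerCorput n (a / 2 ^ m)| ≤ 2 * (Nat.log 2 s + 1) := by
  induction m with
  | zero =>
    intro a s
    have := fractSum_add_int vanDerCorput n a s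
    simp only [pow_zero, div_one]
    push_cast at this
    rw [this, sub_self, abs_zero]
    positivity
  | succ m ih =>
    intro a s
    set D := fractSum vanDerCorput n
    have half : ∀ z : ℤ, ((2 * z : ℤ) : ℝ) / 2 ^ (m + 1) = z / 2 ^ m := by
      intro z; push_cast; rw [pow_succ]; field_simp
    -- `-(-z / 2)` is z/2 rounded up: the left endpoint moves inwards, as the right one does in
    -- `hi`.
    have lo : ∀ z : ℤ, |D ((z : ℝ) / 2 ^ (m + 1)) - D (((-((-z) / 2) : ℤ) : ℝ) / 2 ^ m)| ≤ 1 := by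
      intro z
      rw [← half]
      rcases Int.emod_two_eq_zero_or_one z with hz | hz
      · rw [show 2 * (-(-z / 2)) = z by omega]; simp
      · rw [show 2 * (-(-z / 2)) = z + 1 by omega, abs_sub_comm]
        exact_mod_cast abs_fractSum_vanDerCorput_dyadic_le n (m + 1) z
    have hi : ∀ z : ℤ, |D ((z : ℝ) / 2 ^ (m + 1)) - D (((z / 2 : ℤ) : ℝ) / 2 ^ m)| ≤ 1 := by
      intro z
      rw [← half]
      rcases Int.emod_two_eq_zero_or_one z with hz | hz
      · rw [show 2 * (z / 2) = z by omega]; simp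
      · have := abs_fractSum_vanDerCorput_dyadic_le n (m + 1) (2 * (z / 2))
        rwa [show ((2 * (z / 2) : ℤ) : ℝ) + 1 = z by
          exact_mod_cast (show 2 * (z / 2) + 1 = z by omega)] at this
    rcases Nat.lt_or_ge s 2 with hs | hs
    · interval_cases s
      · simp
      · have := abs_fractSum_vanDerCorput_dyadic_le n (m + 1) a
        simp only [Nat.cast_one, Nat.log_one_right, Nat.cast_zero]
        linarith
    · obtain ⟨s', hs'⟩ := Int.eq_ofNat_of_zero_le (show 0 ≤ (a + s) / 2 - -(-a / 2) by omega)
      have h1 := lo a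
      have h2 := hi (a + s)
      have h3 := ih (-(-a / 2)) s'
      have e : ((-(-a / 2) : ℤ) : ℝ) + s' = ((a + s) / 2 : ℤ) := by
        exact_mod_cast (show -(-a / 2) + (s' : ℤ) = (a + s) / 2 by omega)
      rw [e] at h3
      have hlog : Nat.log 2 s' + 1 ≤ Nat.log 2 s := by
        rw [Nat.log_of_one_lt_of_le (by norm_num) hs]
        have : s' ≤ s / 2 := by omega
        have := Nat.log_mono_right (b := 2) this
        omega
      have hlog' : (Nat.log 2 s' : ℝ) + 1 ≤ Nat.log 2 s := by exact_mod_cast hlog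
      push_cast at h2
      rw [abs_le] at h1 h2 h3 ⊢
      constructor <;> linarith [h1.1, h1.2, h2.1, h2.2, h3.1, h3.2]

theorem abs_fractSum_vanDerCorput_sub_le {n r : ℕ} (hn : 0 < n) (hr : 2 ≤ r) (t : ℝ) :
    |fractSum vanDerCorput n (t + r / n) - fractSum vanDerCorput n t| ≤
      2 * (Nat.log 2 (2 * r + 2) + 1) + 4 := by
  obtain ⟨m, hm1, hm2⟩ : ∃ m, n ≤ 2 ^ m ∧ 2 ^ m ≤ 2 * n := by
    -- Cells of size between 1/(2n) and 1/n: the arc spans r to 2r of them, and one cell carries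
    -- expected mass at most 1.
    refine ⟨Nat.log 2 n + 1, (Nat.lt_pow_succ_log_self (by norm_num) n).le, ?_⟩
    have := Nat.pow_log_le_self 2 hn.ne'
    rw [pow_succ]; omega
  have hP : (0 : ℝ) < 2 ^ m := by positivity
  have hn' : (0 : ℝ) < n := by exact_mod_cast hn
  have hr' : (2 : ℝ) ≤ r := by exact_mod_cast hr
  have hm1' : (n : ℝ) ≤ 2 ^ m := by exact_mod_cast hm1
  have hm2' : (2 : ℝ) ^ m ≤ 2 * n := by exact_mod_cast hm2
  set u := t * 2 ^ m with hu
  set v := (t + r / n) * 2 ^ m with hv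
  have huv : v - u = r * (2 ^ m / n) := by rw [hu, hv]; ring
  have hq1 : 1 ≤ (2 : ℝ) ^ m / n := by rwa [one_le_div hn']
  have hq2 : (2 : ℝ) ^ m / n ≤ 2 := by rwa [div_le_iff₀ hn']
  have hd1 : (r : ℝ) ≤ v - u := by rw [huv]; nlinarith
  have hd2 : v - u ≤ 2 * r := by rw [huv]; nlinarith
  have mono := monotone_fractSum_add_mul vanDerCorput n
  have key := abs_fractSum_vanDerCorput_dyadic_add_le n m
  have et : u / 2 ^ m = t := by rw [hu]; field_simp
  have ev : v / 2 ^ m = t + r / n := by rw [hv]; field_simp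
  have hnP : (n : ℝ) / 2 ^ m ≤ 1 := by rwa [div_le_one hP]
  have small : ∀ w : ℝ, 0 ≤ w → w ≤ 2 → n * (w / 2 ^ m) ≤ 2 := by
    intro w h0 h2
    have : n * (w / 2 ^ m) = n / 2 ^ m * w := by ring
    rw [this]
    have : 0 ≤ (n : ℝ) / 2 ^ m := by positivity
    nlinarith
  have fu := Int.floor_le u
  have fu' := Int.lt_floor_add_one u
  have cu := Int.le_ceil u
  have cu' := Int.ceil_lt_add_one u
  have fv := Int.floor_le v
  have fv' := Int.lt_floor_add_one v
  have cv := Int.le_ceil v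
  have cv' := Int.ceil_lt_add_one v
  set L := Nat.log 2 (2 * r + 2)
  have bound : ∀ a b : ℤ, (a : ℝ) ≤ b → (b : ℝ) - a < 2 * r + 3 →
      |fractSum vanDerCorput n (b / 2 ^ m) - fractSum vanDerCorput n (a / 2 ^ m)|
        ≤ 2 * (L + 1) := by
    intro a b hab hlt
    have hab' : a ≤ b := by exact_mod_cast hab
    obtain ⟨s, hs⟩ := Int.eq_ofNat_of_zero_le (sub_nonneg.2 hab')
    have hlt' : b - a < 2 * r + 3 := by exact_mod_cast hlt
    have h := key a s
    have e : (a : ℝ) + s = b := by exact_mod_cast (show a + (s : ℤ) = b by omega)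
    rw [e] at h
    have : Nat.log 2 s ≤ L := Nat.log_mono_right (by omega)
    have : (Nat.log 2 s : ℝ) ≤ L := by exact_mod_cast this
    linarith
  -- Sandwich the arc between its outer and inner grid roundings; `r ≥ 2` keeps the inner one from
  -- being reversed.
  have hout := bound ⌊u⌋ ⌈v⌉ (by linarith) (by linarith)
  have hin := bound ⌈u⌉ ⌊v⌋ (by
    have : ⌈u⌉ < ⌊v⌋ + 1 := by
      have : (⌈u⌉ : ℝ) < ⌊v⌋ + 1 := by linarith
      exact_mod_cast this
    exact_mod_cast Int.lt_add_one_iff.1 this) (by linarith)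
  have scale : ∀ {p q : ℝ}, p ≤ q → fractSum vanDerCorput n (p / 2 ^ m) + n * (p / 2 ^ m) ≤
      fractSum vanDerCorput n (q / 2 ^ m) + n * (q / 2 ^ m) := by
    intro p q hpq
    apply mono
    gcongr
  have m1 := scale fu
  have m2 := scale cu
  have m3 := scale fv
  have m4 := scale cv
  have s1 := small (u - ⌊u⌋) (by linarith) (by linarith)
  have s2 := small (⌈u⌉ - u) (by linarith) (by linarith)
  have s3 := small (v - ⌊v⌋) (by linarith) (by linarith)
  have s4 := small (⌈v⌉ - v) (by linarith) (by linarith)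
  rw [sub_div, mul_sub] at s1 s2 s3 s4
  rw [et] at m1 m2 s1 s2
  rw [ev] at m3 m4 s3 s4
  rw [abs_le] at hin hout ⊢
  constructor <;> linarith [hin.1, hin.2, hout.1, hout.2]

/-! ### The golden rotation -/

theorem image_emod_range_of_coprime {p q : ℕ} (hq : 0 < q) (hpq : Nat.Coprime q p) (z : ℤ) :
    (Finset.range q).image (fun k : ℕ => ((z + k * p) % q).toNat) = Finset.range q ∧
      Set.InjOn (fun k : ℕ => ((z + k * p) % q).toNat) (Finset.range q : Set ℕ) := by
  have hq' : (0 : ℤ) < q := by exact_mod_cast hq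
  have inj : Set.InjOn (fun k : ℕ => ((z + k * p) % q).toNat) (Finset.range q : Set ℕ) := by
    intro k hk l hl hkl
    simp only [Finset.coe_range, Set.mem_Iio] at hk hl
    have h1 := Int.emod_nonneg (z + k * p) hq'.ne'
    have h2 := Int.emod_nonneg (z + l * p) hq'.ne'
    have h3 : (z + k * p) % q = (z + l * p) % q := by simp only at hkl; omega
    have h4 : (q : ℤ) ∣ (l - k) * p := by
      have := Int.ModEq.dvd h3
      rwa [show z + l * p - (z + k * p) = ((l : ℤ) - k) * p by ring] at this
    have h5 : (q : ℤ) ∣ (l : ℤ) - k :=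
      IsCoprime.dvd_of_dvd_mul_right (Nat.isCoprime_iff_coprime.2 hpq) h4
    have h6 : (l : ℤ) - k = 0 := by
      apply Int.eq_zero_of_abs_lt_dvd h5
      rw [abs_lt]
      constructor <;> omega
    omega
  refine ⟨Finset.eq_of_subset_of_card_le ?_ ?_, inj⟩
  · intro j hj
    obtain ⟨k, -, rfl⟩ := Finset.mem_image.1 hj
    have h1 := Int.emod_nonneg (z + k * p) hq'.ne'
    have h2 := Int.emod_lt_of_pos (z + k * p) hq'
    rw [Finset.mem_range]
    omega
  · rw [Finset.card_image_of_injOn inj]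

/-- Hermite's identity for fractional parts along a rational rotation. -/
theorem sum_fract_add_mul_div {p q : ℕ} (hq : 0 < q) (hpq : Nat.Coprime q p) (s : ℝ) :
    ∑ k ∈ Finset.range q, Int.fract (s + k * p / q) = (q - 1) / 2 + Int.fract (q * s) := by
  have hq' : (0 : ℤ) < q := by exact_mod_cast hq
  have hqr : (0 : ℝ) < q := by exact_mod_cast hq
  set z := ⌊(q : ℝ) * s⌋
  set θ := Int.fract ((q : ℝ) * s)
  have hθ0 : 0 ≤ θ := Int.fract_nonneg _
  have hθ1 : θ < 1 := Int.fract_lt_one _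
  have hz : (z : ℝ) + θ = q * s := Int.floor_add_fract _
  -- With qs = z + θ the fractional parts are (j + θ)/q, where j runs once through all residues mod
  -- q.
  have term : ∀ k : ℕ, Int.fract (s + k * p / q) =
      ((((z + k * p) % q).toNat : ℕ) : ℝ) / q + θ / q := by
    intro k
    have h1 := Int.emod_nonneg (z + k * p) hq'.ne'
    have h2 := Int.emod_lt_of_pos (z + k * p) hq'
    have h3 := Int.mul_ediv_add_emod (z + k * p) q
    set w := (z + k * p) % q
    have hw : ((w.toNat : ℕ) : ℝ) = (w : ℝ) := by
      exact_mod_cast Int.toNat_of_nonneg h1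
    have hw0 : (0 : ℝ) ≤ w := by exact_mod_cast h1
    have hw1 : (w : ℝ) + 1 ≤ q := by exact_mod_cast h2
    rw [hw, ← add_div, Int.fract_eq_iff]
    refine ⟨by positivity, by rw [div_lt_one hqr]; linarith, (z + k * p) / q, ?_⟩
    have h3' : (q : ℝ) * (((z + k * p) / q : ℤ) : ℝ) + w = z + k * p := by exact_mod_cast h3
    field_simp
    linarith
  obtain ⟨him, hinj⟩ := image_emod_range_of_coprime hq hpq z
  have hsum : ∑ k ∈ Finset.range q, ((((z + k * p) % q).toNat : ℕ) : ℝ) =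
      ∑ j ∈ Finset.range q, (j : ℝ) := by
    conv_rhs => rw [← him]
    rw [Finset.sum_image hinj]
  have hg : ∑ j ∈ Finset.range q, (j : ℝ) = q * (q - 1) / 2 := by
    have := Finset.sum_range_id_mul_two q
    have h : ((∑ j ∈ Finset.range q, j : ℕ) : ℝ) * 2 = q * ((q - 1 : ℕ) : ℝ) := by
      exact_mod_cast this
    rw [Nat.cast_sub hq] at h
    push_cast at h
    linarith
  rw [Finset.sum_congr rfl fun k _ => term k, Finset.sum_add_distrib, ← Finset.sum_div, hsum, hg,
    Finset.sum_const, Finset.card_range, nsmul_eq_mul]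
  field_simp

/-- The Denjoy–Koksma inequality for the fractional part. -/
theorem abs_sum_fract_rotation_sub_le {p q : ℕ} (hq : 0 < q) (hpq : Nat.Coprime q p) {α : ℝ}
    (hα : |q * α - p| ≤ 1 / q) (s : ℝ) :
    |∑ k ∈ Finset.range q, Int.fract (s + k * α) - q / 2| ≤ 5 / 2 := by
  have hqr : (0 : ℝ) < q := by exact_mod_cast hq
  have close : ∀ k ∈ Finset.range q, |(k : ℝ) * α - k * p / q| ≤ 1 / q := by
    intro k hk
    have hk' : (k : ℝ) ≤ q := by exact_mod_cast (Finset.mem_range.1 hk).le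
    have e : (k : ℝ) * α - k * p / q = k / q * (q * α - p) := by field_simp
    rw [e, abs_mul, abs_of_nonneg (by positivity)]
    have : (k : ℝ) / q ≤ 1 := by rwa [div_le_one hqr]
    calc (k : ℝ) / q * |q * α - p| ≤ 1 * (1 / q) := by gcongr
      _ = 1 / q := one_mul _
  have hc : ∑ _k ∈ Finset.range q, (2 : ℝ) / q = 2 := by
    rw [Finset.sum_const, Finset.card_range, nsmul_eq_mul]; field_simp
  -- Moving the base point by 1/q makes the rational orbit lie on one side of the true one, so the
  -- floors compare; each term then loses at most 2/q.
  have up : ∑ k ∈ Finset.range q, Int.fract (s + k * α) ≤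
      ∑ k ∈ Finset.range q, (Int.fract ((s - 1 / q) + k * p / q) + 2 / q) := by
    refine Finset.sum_le_sum fun k hk => ?_
    have h := abs_le.1 (close k hk)
    have : ⌊(s - 1 / q) + k * p / q⌋ ≤ ⌊s + k * α⌋ := Int.floor_mono (by linarith [h.1])
    have : ((⌊(s - 1 / q) + k * p / q⌋ : ℤ) : ℝ) ≤ ⌊s + k * α⌋ := by exact_mod_cast this
    have e : (2 : ℝ) / q = 1 / q + 1 / q := by ring
    unfold Int.fract
    linarith [h.2]
  have lo : ∑ k ∈ Finset.range q, (Int.fract ((s + 1 / q) + k * p / q) - 2 / q) ≤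
      ∑ k ∈ Finset.range q, Int.fract (s + k * α) := by
    refine Finset.sum_le_sum fun k hk => ?_
    have h := abs_le.1 (close k hk)
    have : ⌊s + k * α⌋ ≤ ⌊(s + 1 / q) + k * p / q⌋ := Int.floor_mono (by linarith [h.2])
    have : ((⌊s + k * α⌋ : ℤ) : ℝ) ≤ ⌊(s + 1 / q) + k * p / q⌋ := by exact_mod_cast this
    have e : (2 : ℝ) / q = 1 / q + 1 / q := by ring
    unfold Int.fract
    linarith [h.1]
  rw [Finset.sum_add_distrib, hc, sum_fract_add_mul_div hq hpq] at up
  rw [Finset.sum_sub_distrib, hc, sum_fract_add_mul_div hq hpq] at lo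
  have h1 := Int.fract_lt_one ((q : ℝ) * (s - 1 / q))
  have h2 := Int.fract_nonneg ((q : ℝ) * (s + 1 / q))
  rw [abs_le]
  constructor <;> linarith

open Real in
-- Denjoy–Koksma applies since |F_j φ - F_{j+1}| = φ⁻ʲ ≤ 1/F_j.
theorem abs_sum_fract_goldenRatio_sub_le (j : ℕ) (s : ℝ) :
    |∑ k ∈ Finset.range (Nat.fib j), Int.fract (s + k * goldenRatio) - Nat.fib j / 2| ≤ 5 / 2 := by
  rcases Nat.eq_zero_or_pos j with rfl | hj
  · norm_num
  have hq : 0 < Nat.fib j := Nat.fib_pos.2 hj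
  refine abs_sum_fract_rotation_sub_le hq (Nat.fib_coprime_fib_succ j) ?_ s
  have hqr : (0 : ℝ) < Nat.fib j := by exact_mod_cast hq
  have h1 := fib_succ_sub_goldenRatio_mul_fib j
  have e : (Nat.fib j : ℝ) * goldenRatio - Nat.fib (j + 1) = -goldenConj ^ j := by
    rw [← h1]; ring
  have hpow : |goldenConj ^ j| = 1 / goldenRatio ^ j := by
    rw [abs_pow, abs_of_neg goldenConj_neg, ← inv_goldenRatio, inv_pow, one_div]
  rw [e, abs_neg, hpow]
  apply one_div_le_one_div_of_le hqr
  rw [← fib_succ_sub_goldenConj_mul_fib]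
  have : (Nat.fib j : ℝ) ≤ Nat.fib (j + 1) := by exact_mod_cast Nat.fib_le_fib_succ
  nlinarith [goldenConj_neg]

theorem fractSum_goldenKronecker (n : ℕ) (t : ℝ) :
    fractSum goldenKronecker n t =
      ∑ k ∈ Finset.Ioc 0 n, Int.fract (-t + k * Real.goldenRatio) := by
  unfold fractSum goldenKronecker
  refine Finset.sum_congr rfl fun k _ => ?_
  have : Int.fract ((k : ℝ) * Real.goldenRatio) - t =
      (-t + k * Real.goldenRatio) - ⌊(k : ℝ) * Real.goldenRatio⌋ := by
    unfold Int.fract; ring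
  rw [this, Int.fract_sub_intCast]

/-- Translating by -F_j φ shifts the summation index by F_j, so all terms cancel except two blocks
of F_j consecutive ones, each within 5/2 of F_j/2. -/
theorem abs_fractSum_golden_sub_fib_mul_le (n j : ℕ) (t : ℝ) :
    |fractSum goldenKronecker n (t - Nat.fib j * Real.goldenRatio) -
      fractSum goldenKronecker n t| ≤ 5 := by
  set q := Nat.fib j
  set φ := Real.goldenRatio
  let f : ℕ → ℝ := fun k => Int.fract ((-t + φ) + k * φ)
  have range_form : ∀ u : ℝ, fractSum goldenKronecker n u =
      ∑ k ∈ Finset.range n, Int.fract ((-u + φ) + k * φ) := by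
    intro u
    rw [fractSum_goldenKronecker, ← Finset.Ico_add_one_add_one_eq_Ioc, Finset.sum_Ico_eq_sum_range]
    refine Finset.sum_congr (by simp) fun k _ => ?_
    congr 1
    push_cast
    ring
  have e1 : fractSum goldenKronecker n t = ∑ k ∈ Finset.range n, f k := range_form t
  have e2 : fractSum goldenKronecker n (t - q * φ) = ∑ k ∈ Finset.range n, f (q + k) := by
    rw [range_form]
    refine Finset.sum_congr rfl fun k _ => ?_
    simp only [f]
    congr 1
    push_cast
    ring
  have s1 := Finset.sum_range_add f q n
  have s2 := Finset.sum_range_add f n q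
  rw [add_comm n q] at s2
  have b1 := abs_sum_fract_goldenRatio_sub_le j (-t + φ)
  have b2 := abs_sum_fract_goldenRatio_sub_le j (-t + φ + n * φ)
  have e3 : ∑ k ∈ Finset.range q, Int.fract (-t + φ + n * φ + k * φ) =
      ∑ k ∈ Finset.range q, f (n + k) := by
    refine Finset.sum_congr rfl fun k _ => ?_
    simp only [f]
    congr 1
    push_cast
    ring
  change |∑ k ∈ Finset.range q, f k - q / 2| ≤ 5 / 2 at b1
  change |∑ k ∈ Finset.range q, Int.fract (-t + φ + n * φ + k * φ) - q / 2| ≤ 5 / 2 at b2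
  rw [e3] at b2
  rw [e1, e2]
  rw [abs_le] at b1 b2 ⊢
  constructor <;> linarith [b1.1, b1.2, b2.1, b2.2]

open Real in
-- Modulo 1, translation by -F_j φ is translation by F_{j+1} - F_j φ = (-1)ʲ φ⁻ʲ; for odd j the arc
-- is read backwards.
theorem abs_fractSum_golden_add_pow_le (n j : ℕ) (t : ℝ) :
    |fractSum goldenKronecker n (t + goldenRatio⁻¹ ^ j) - fractSum goldenKronecker n t| ≤ 5 := by
  have key : ∀ u : ℝ, |fractSum goldenKronecker n (u + goldenConj ^ j) -
      fractSum goldenKronecker n u| ≤ 5 := by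
    intro u
    have h := abs_fractSum_golden_sub_fib_mul_le n j u
    rw [← fractSum_add_int _ _ _ (Nat.fib (j + 1) : ℤ)] at h
    rw [← fib_succ_sub_goldenRatio_mul_fib j]
    convert h using 4
    push_cast
    ring
  rw [inv_goldenRatio]
  rcases Nat.even_or_odd j with hj | hj
  · rw [hj.neg_pow]; exact key t
  · have h := key (t + (-goldenConj) ^ j)
    rw [hj.neg_pow, neg_add_cancel_right, abs_sub_comm] at h
    rw [hj.neg_pow]; exact h

open Real in
-- Greedy expansion of `L` in powers of φ⁻¹: each of `i` digits costs at most 5, and monotonicity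
-- handles the remainder, shorter than or equal to φ^-(m+i).
theorem abs_fractSum_golden_add_le (n : ℕ) (i : ℕ) :
    ∀ (m : ℕ) (L t : ℝ), 0 ≤ L → L ≤ goldenRatio⁻¹ ^ m →
      |fractSum goldenKronecker n (t + L) - fractSum goldenKronecker n t| ≤
        5 * i + n * goldenRatio⁻¹ ^ (m + i) + 5 := by
  induction i with
  | zero =>
    intro m L t h0 h1
    have mono := monotone_fractSum_add_mul goldenKronecker n
    have m1 := mono (show t ≤ t + L by linarith)
    have m2 := mono (show t + L ≤ t + goldenRatio⁻¹ ^ m by linarith)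
    have b := abs_le.1 (abs_fractSum_golden_add_pow_le n m t)
    have hn : (0 : ℝ) ≤ n := Nat.cast_nonneg n
    have hL : 0 ≤ n * L := mul_nonneg hn h0
    have hL' : n * L ≤ n * goldenRatio⁻¹ ^ m := mul_le_mul_of_nonneg_left h1 hn
    simp only [mul_add] at m1 m2
    rw [abs_le]
    push_cast
    rw [add_zero]
    constructor <;> linarith [b.1, b.2]
  | succ i ih =>
    intro m L t h0 h1
    have e : m + (i + 1) = m + 1 + i := by omega
    rw [e]
    push_cast
    rcases le_total L (goldenRatio⁻¹ ^ (m + 1)) with h | h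
    · have := ih (m + 1) L t h0 h
      linarith
    · have hpos : 0 < goldenRatio⁻¹ := inv_pos.2 goldenRatio_pos
      have hlt : goldenRatio⁻¹ ≤ 1 := inv_le_one_of_one_le₀ one_lt_goldenRatio.le
      have hsq : goldenRatio⁻¹ ^ 2 = 1 - goldenRatio⁻¹ := by
        rw [inv_goldenRatio, neg_sq, goldenConj_sq]; ring
      have e1 : goldenRatio⁻¹ ^ m - goldenRatio⁻¹ ^ (m + 1) = goldenRatio⁻¹ ^ (m + 2) := by
        rw [pow_add, pow_add, hsq]; ring
      have e2 : goldenRatio⁻¹ ^ (m + 2) ≤ goldenRatio⁻¹ ^ (m + 1) :=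
        pow_le_pow_of_le_one hpos.le hlt (by omega)
      have b1 := ih (m + 1) (L - goldenRatio⁻¹ ^ (m + 1)) (t + goldenRatio⁻¹ ^ (m + 1))
        (by linarith) (by linarith)
      have b2 := abs_fractSum_golden_add_pow_le n (m + 1) t
      rw [add_add_sub_cancel] at b1
      rw [abs_le] at b1 b2 ⊢
      constructor <;> linarith [b1.1, b1.2, b2.1, b2.2]

open Real in
theorem abs_fractSum_goldenKronecker_sub_le {n r : ℕ} (hr : 2 ≤ r) (hrn : r ≤ n) (t : ℝ) :
    |fractSum goldenKronecker n (t + r / n) - fractSum goldenKronecker n t| ≤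
      10 * (Nat.log 2 r + 1) + 7 := by
  have hn : (0 : ℝ) < n := by exact_mod_cast (by omega : 0 < n)
  have hr' : (0 : ℝ) < r := by exact_mod_cast (by omega : 0 < r)
  have hpos : 0 < goldenRatio⁻¹ := inv_pos.2 goldenRatio_pos
  obtain ⟨m, hm1, hm2⟩ := exists_nat_pow_near_of_lt_one (x := (r : ℝ) / n) (by positivity)
    (by rw [div_le_one hn]; exact_mod_cast hrn) hpos (inv_lt_one_of_one_lt₀ one_lt_goldenRatio)
  -- As φ² ≥ 2, `2 * l` digits shrink the scale by at least r, leaving expected mass at most 2.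
  set l := Nat.log 2 r + 1
  have b := abs_fractSum_golden_add_le n (2 * l) m (r / n) t (by positivity) hm2
  have hl : (r : ℝ) ≤ goldenRatio ^ (2 * l) := by
    have h1 : (r : ℝ) ≤ 2 ^ l := by exact_mod_cast (Nat.lt_pow_succ_log_self (by norm_num) r).le
    have h2 : (2 : ℝ) ≤ goldenRatio ^ 2 := by rw [goldenRatio_sq]; linarith [one_lt_goldenRatio]
    rw [pow_mul]
    exact h1.trans (by gcongr)
  have hsmall : n * goldenRatio⁻¹ ^ (m + 2 * l) ≤ 2 := by
    have e : (n : ℝ) * goldenRatio⁻¹ ^ (m + 2 * l) =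
        n * goldenRatio⁻¹ ^ (m + 1) * goldenRatio / goldenRatio ^ (2 * l) := by
      rw [pow_add, inv_pow _ (2 * l), pow_succ, div_eq_mul_inv, mul_assoc (n : ℝ) _ goldenRatio,
        inv_mul_cancel_right₀ goldenRatio_ne_zero, mul_assoc]
    rw [e, div_le_iff₀ (pow_pos goldenRatio_pos _)]
    have h1 : n * goldenRatio⁻¹ ^ (m + 1) ≤ r := by
      rw [lt_div_iff₀ hn] at hm1; linarith
    calc n * goldenRatio⁻¹ ^ (m + 1) * goldenRatio ≤ r * 2 := by
          gcongr
          exact goldenRatio_lt_two.le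
      _ ≤ 2 * goldenRatio ^ (2 * l) := by linarith
  have hl' : ((Nat.log 2 r : ℝ)) + 1 = l := by simp [l]
  rw [hl']
  push_cast at b
  linarith

/-! ### Natural logarithms and the two statements -/

theorem log_two_le_mul_log {s : ℕ} : (Nat.log 2 s : ℝ) ≤ 2 * Real.log s := by
  rcases Nat.eq_zero_or_pos s with rfl | hs
  · simp
  have h : ((2 : ℝ) ^ Nat.log 2 s) ≤ s := by exact_mod_cast Nat.pow_log_le_self 2 hs.ne'
  have h' := Real.log_le_log (by positivity) h
  rw [Real.log_pow] at h'
  have : (Nat.log 2 s : ℝ) * (1 / 2) ≤ Nat.log 2 s * Real.log 2 := by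
    gcongr
    linarith [Real.log_two_gt_d9]
  linarith

theorem abs_fractSum_add_div_sub_le {x : ℕ → ℝ} (hx : x = vanDerCorput ∨ x = goldenKronecker)
    {n r : ℕ} (hr : 2 ≤ r) (hrn : r ≤ n) (t : ℝ) :
    |fractSum x n (t + r / n) - fractSum x n t| ≤ 60 * Real.log r := by
  have hr' : (2 : ℝ) ≤ r := by exact_mod_cast hr
  have hlog : 1 / 2 ≤ Real.log r := by
    have := Real.log_le_log (by norm_num) hr'
    linarith [Real.log_two_gt_d9]
  rcases hx with rfl | rfl
  · refine (abs_fractSum_vanDerCorput_sub_le (by omega) hr t).trans ?_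
    have h1 := log_two_le_mul_log (s := 2 * r + 2)
    have h2 : Real.log (2 * r + 2 : ℕ) ≤ 3 * Real.log r := by
      rw [show (3 : ℝ) * Real.log r = Real.log ((r : ℝ) ^ 3) by rw [Real.log_pow]; norm_num]
      apply Real.log_le_log (by positivity)
      push_cast
      nlinarith [mul_nonneg (sub_nonneg.2 hr') (sub_nonneg.2 hr')]
    linarith
  · refine (abs_fractSum_goldenKronecker_sub_le hr hrn t).trans ?_
    have h1 := log_two_le_mul_log (s := r)
    linarith

/-- The upper bound uses an arc of length (r+1)/n, hence `r + 1 ≤ n`. Its cost 60 log(r+1) + 1 is at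
most 122 log r, as r + 1 ≤ r² and log r ≥ 1/2. -/
theorem abs_ncard_circleArc_sub_le {x : ℕ → ℝ} (hx : x = vanDerCorput ∨ x = goldenKronecker)
    {n r : ℕ} (hr : 2 ≤ r) (hrn : r + 1 ≤ n) (t : ℝ) :
    |(({k : ℕ | 1 ≤ k ∧ k ≤ n ∧ (x k : UnitAddCircle) ∈ circleArc t ((r : ℝ) / n)}.ncard : ℕ) : ℝ)
      - r| ≤ 122 * Real.log r := by
  have hn : (0 : ℝ) < n := by exact_mod_cast (by omega : 0 < n)
  have hr' : (2 : ℝ) ≤ r := by exact_mod_cast hr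
  have hlog : 1 / 2 ≤ Real.log r := by
    have := Real.log_le_log (by norm_num) hr'
    linarith [Real.log_two_gt_d9]
  have lo := le_ncard_circleArc x n (t := t) (L := (r : ℝ) / n)
    (by rw [div_le_one hn]; exact_mod_cast (by omega : r ≤ n))
  have up := ncard_circleArc_le x n (t := t) (L := (r : ℝ) / n) (M := ((r + 1 : ℕ) : ℝ) / n)
    (by positivity) (by gcongr; omega)
  have b1 := abs_le.1 (abs_fractSum_add_div_sub_le hx hr (by omega : r ≤ n) t)
  have b2 := abs_le.1 (abs_fractSum_add_div_sub_le hx (by omega : 2 ≤ r + 1) hrn t)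
  have hlog2 : Real.log (r + 1 : ℕ) ≤ 2 * Real.log r := by
    rw [show (2 : ℝ) * Real.log r = Real.log ((r : ℝ) ^ 2) by rw [Real.log_pow]; norm_num]
    apply Real.log_le_log (by positivity)
    push_cast
    nlinarith
  rw [mul_div_cancel₀ _ hn.ne'] at lo up
  push_cast at up b2 hlog2
  rw [abs_le]
  constructor <;> linarith [b1.1, b1.2, b2.1, b2.2]

theorem goldenKronecker_pos {k : ℕ} (hk : 0 < k) : 0 < goldenKronecker k := by
  refine lt_of_le_of_ne (Int.fract_nonneg _) fun h => ?_
  have hirr := Real.goldenRatio_irrational.natCast_mul hk.ne'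
  refine hirr.ne_int ⌊(k : ℝ) * Real.goldenRatio⌋ ?_
  unfold goldenKronecker at h
  have := Int.floor_add_fract ((k : ℝ) * Real.goldenRatio)
  linarith

theorem mem_Ioo_of_vanDerCorput_or_goldenKronecker {x : ℕ → ℝ}
    (hx : x = vanDerCorput ∨ x = goldenKronecker) {k : ℕ} (hk : 0 < k) :
    x k ∈ Set.Ioo (0 : ℝ) 1 := by
  rcases hx with rfl | rfl
  · exact ⟨vanDerCorput_pos hk, (vanDerCorput_mem_Ico k).2⟩
  · exact ⟨goldenKronecker_pos hk, Int.fract_lt_one _⟩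

/-- Excluding 0 matters: when t + L = 1 the arc contains the class of 0 but the interval may not
contain the number 0. -/
theorem coe_mem_circleArc_iff_of_mem_Ioo {y t L : ℝ} (hy : y ∈ Set.Ioo (0 : ℝ) 1) (ht : 0 ≤ t)
    (htL : t + L ≤ 1) : (y : UnitAddCircle) ∈ circleArc t L ↔ t ≤ y ∧ y ≤ t + L := by
  rw [coe_mem_circleArc_iff]
  constructor
  · rintro ⟨z, h1, h2⟩
    have hz1 : (z : ℝ) < 1 := by linarith [hy.1]
    have hz2 : (-1 : ℝ) < z := by linarith [hy.2]
    have hz1' : z < 1 := by exact_mod_cast hz1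
    have hz2' : -1 < z := by exact_mod_cast hz2
    obtain rfl : z = 0 := by omega
    simpa using And.intro h1 h2
  · rintro ⟨h1, h2⟩
    exact ⟨0, by simpa using h1, by simpa using h2⟩

theorem theorem3 :
    ∃ c : ℝ, 0 < c ∧
      ∀ x : ℕ → ℝ, (x = vanDerCorput ∨ x = goldenKronecker) →
        ∀ r : ℕ, 2 ≤ r → ∃ N : ℕ, ∀ n : ℕ, N ≤ n →
          (∀ t : ℝ, 0 ≤ t → t ≤ 1 - (r : ℝ) / n →
            |(({k : ℕ | 1 ≤ k ∧ k ≤ n ∧ t ≤ x k ∧ x k ≤ t + (r : ℝ) / n}.ncard : ℕ) : ℝ) - r|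
              ≤ c * Real.log r) ∧
          (∀ t : ℝ,
            |(({k : ℕ | 1 ≤ k ∧ k ≤ n ∧
                (x k : UnitAddCircle) ∈ circleArc t ((r : ℝ) / n)}.ncard : ℕ) : ℝ) - r|
              ≤ c * Real.log r) := by
  refine ⟨122, by norm_num, fun x hx r hr => ⟨r + 1, fun n hn => ⟨fun t ht0 ht1 => ?_, fun t =>
    abs_ncard_circleArc_sub_le hx hr hn t⟩⟩⟩
  have h := abs_ncard_circleArc_sub_le hx hr hn t
  have e : {k : ℕ | 1 ≤ k ∧ k ≤ n ∧ (x k : UnitAddCircle) ∈ circleArc t ((r : ℝ) / n)} =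
      {k : ℕ | 1 ≤ k ∧ k ≤ n ∧ t ≤ x k ∧ x k ≤ t + (r : ℝ) / n} := by
    ext k
    refine and_congr_right fun hk => and_congr_right fun _ => ?_
    exact coe_mem_circleArc_iff_of_mem_Ioo (mem_Ioo_of_vanDerCorput_or_goldenKronecker hx hk) ht0
      (by linarith)
  rwa [e] at h
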